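/- Let $n\ge 1$ and let $\mathbf M=\begin{bmatrix} M_{11} & M_{12}\\ M_{12}^* & M_{22}\end{bmatrix}$ be a positive semidefinite complex matrix with $n\times n$ blocks, whose off-diagonal block $M_{12}$ is unitary. For positive definite $A,B$ let $A\sharp B=B^{1/2}(B^{-1/2}AB^{-1/2})^{1/2}B^{1/2}$ be the geometric mean, and for positive semidefinite $A,B$ let $A\sharp B=\lim_{\epsilon\to0^+}(A+\epsilon I_n)\sharp(B+\epsilon I_n)$. Denote by $s_1(X)\ge\dots\ge s_n(X)$ the singular values of an $n\times n$ matrix $X$ and, if $X$ is Hermitian, by $\lambda_1(X)\ge\dots\ge\lambda_n(X)$ its eigenvalues. Then $$1=\prod_{j=1}^k s_j(M_{12})\le\prod_{j=1}^k\lambda_j(M_{11}\sharp M_{22}),\qquad k=1,\dots,n.$$ In particular $\mathbf M$ has the $\mathfrak{lg}$-property, that is, $\prod_{j=1}^k s_j(M_{12})\le\prod_{j=1}^k\lambda_j(M_{11}\sharp M_{22})$ for $k=1,\dots,n$. -/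

import Mathlib

open scoped ComplexOrder MatrixOrder

/-- The geometric mean of positive definite matrices by the explicit formula
`A ♯ B = B^{1/2} (B^{-1/2} A B^{-1/2})^{1/2} B^{1/2}`. -/
noncomputable def geomMeanPosDef {n : ℕ} (A B : Matrix (Fin n) (Fin n) ℂ) :
    Matrix (Fin n) (Fin n) ℂ :=
  CFC.sqrt B * CFC.sqrt ((CFC.sqrt B)⁻¹ * A * (CFC.sqrt B)⁻¹) * CFC.sqrt B

/-- The geometric mean of positive semidefinite matrices,
`A ♯ B = lim_{ε → 0⁺} (A + ε I) ♯ (B + ε I)`. The limit exists (`tendsto_geomMean`), and for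
positive definite `A`, `B` it is given by the explicit formula (`geomMean_eq_of_posDef`). -/
noncomputable def geomMean {n : ℕ} (A B : Matrix (Fin n) (Fin n) ℂ) :
    Matrix (Fin n) (Fin n) ℂ :=
  Filter.limUnder (nhdsWithin (0 : ℝ) (Set.Ioi 0)) fun ε : ℝ =>
    geomMeanPosDef (A + (ε : ℂ) • (1 : Matrix (Fin n) (Fin n) ℂ))
      (B + (ε : ℂ) • (1 : Matrix (Fin n) (Fin n) ℂ))

theorem posDef_sqrt {n : ℕ} {B : Matrix (Fin n) (Fin n) ℂ} (hB : B.PosDef) :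
    (CFC.sqrt B).PosDef := by
  have h : (CFC.sqrt B).PosSemidef := Matrix.nonneg_iff_posSemidef.1 (CFC.sqrt_nonneg B)
  refine h.posDef_iff_isUnit.2 ?_
  have h2 : CFC.sqrt B * CFC.sqrt B = B := CFC.sqrt_mul_sqrt_self B hB.posSemidef.nonneg
  have h3 := hB.isUnit
  rw [← h2] at h3
  exact isUnit_of_mul_isUnit_left h3

theorem posDef_conj {n : ℕ} {A S : Matrix (Fin n) (Fin n) ℂ} (hA : A.PosDef) (hS : S.PosDef) :
    (S * A * S).PosDef := by
  have h := (Matrix.IsUnit.posDef_star_left_conjugate_iff (x := A) hS.isUnit).2 hA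
  rwa [Matrix.star_eq_conjTranspose, hS.isHermitian.eq] at h

theorem geomMeanPosDef_posDef {n : ℕ} {A B : Matrix (Fin n) (Fin n) ℂ}
    (hA : A.PosDef) (hB : B.PosDef) : (geomMeanPosDef A B).PosDef :=
  posDef_conj (posDef_sqrt (posDef_conj hA (posDef_sqrt hB).inv)) (posDef_sqrt hB)

/-- The geometric mean solves the Riccati equation `X B⁻¹ X = A`. -/
theorem geomMeanPosDef_riccati {n : ℕ} {A B : Matrix (Fin n) (Fin n) ℂ}
    (hA : A.PosDef) (hB : B.PosDef) :
    geomMeanPosDef A B * B⁻¹ * geomMeanPosDef A B = A := by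
  have hS := posDef_sqrt hB
  have hSS : CFC.sqrt B * CFC.sqrt B = B := CFC.sqrt_mul_sqrt_self B hB.posSemidef.nonneg
  have hT : CFC.sqrt ((CFC.sqrt B)⁻¹ * A * (CFC.sqrt B)⁻¹) *
      CFC.sqrt ((CFC.sqrt B)⁻¹ * A * (CFC.sqrt B)⁻¹) = (CFC.sqrt B)⁻¹ * A * (CFC.sqrt B)⁻¹ :=
    CFC.sqrt_mul_sqrt_self _ (posDef_conj hA hS.inv).posSemidef.nonneg
  have hBi : B⁻¹ = (CFC.sqrt B)⁻¹ * (CFC.sqrt B)⁻¹ := by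
    conv_lhs => rw [← hSS]
    exact Matrix.mul_inv_rev _ _
  unfold geomMeanPosDef
  rw [hBi]
  generalize CFC.sqrt ((CFC.sqrt B)⁻¹ * A * (CFC.sqrt B)⁻¹) = T at hT ⊢
  generalize CFC.sqrt B = S at hS hT ⊢
  have hu : IsUnit S.det := (Matrix.isUnit_iff_isUnit_det S).1 hS.isUnit
  have h1 : S * S⁻¹ = 1 := Matrix.mul_nonsing_inv S hu
  have h2 : S⁻¹ * S = 1 := Matrix.nonsing_inv_mul S hu
  calc S * T * S * (S⁻¹ * S⁻¹) * (S * T * S)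
      = S * T * (S * S⁻¹) * (S⁻¹ * S) * T * S := by simp only [mul_assoc]
    _ = S * (T * T) * S := by rw [h1, h2]; simp only [mul_assoc, mul_one]
    _ = (S * S⁻¹) * A * (S⁻¹ * S) := by rw [hT]; simp only [mul_assoc]
    _ = A := by rw [h1, h2, mul_one, one_mul]

/-- It is the only positive definite solution. -/
theorem eq_geomMeanPosDef {n : ℕ} {A B X : Matrix (Fin n) (Fin n) ℂ}
    (hB : B.PosDef) (hX : X.PosDef) (h : X * B⁻¹ * X = A) : X = geomMeanPosDef A B := by
  have hS := posDef_sqrt hB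
  have hSS : CFC.sqrt B * CFC.sqrt B = B := CFC.sqrt_mul_sqrt_self B hB.posSemidef.nonneg
  have hBi : B⁻¹ = (CFC.sqrt B)⁻¹ * (CFC.sqrt B)⁻¹ := by
    conv_lhs => rw [← hSS]
    exact Matrix.mul_inv_rev _ _
  have hu : IsUnit (CFC.sqrt B).det := (Matrix.isUnit_iff_isUnit_det _).1 hS.isUnit
  have h1 := Matrix.mul_nonsing_inv _ hu
  have h2 := Matrix.nonsing_inv_mul _ hu
  have hq : CFC.sqrt ((CFC.sqrt B)⁻¹ * A * (CFC.sqrt B)⁻¹) =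
      (CFC.sqrt B)⁻¹ * X * (CFC.sqrt B)⁻¹ := by
    refine CFC.sqrt_unique ?_ (posDef_conj hX hS.inv).posSemidef.nonneg
    rw [← h, hBi]
    simp only [mul_assoc]
  rw [geomMeanPosDef, hq]
  generalize CFC.sqrt B = S at h1 h2
  calc X = (S * S⁻¹) * X * (S⁻¹ * S) := by rw [h1, h2, mul_one, one_mul]
    _ = _ := by simp only [mul_assoc]

theorem geomMeanPosDef_comm {n : ℕ} {A B : Matrix (Fin n) (Fin n) ℂ}
    (hA : A.PosDef) (hB : B.PosDef) : geomMeanPosDef A B = geomMeanPosDef B A := by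
  have hX := geomMeanPosDef_posDef hA hB
  refine eq_geomMeanPosDef hA hX ?_
  have h := geomMeanPosDef_riccati hA hB
  generalize geomMeanPosDef A B = X at hX h
  have hu : IsUnit X.det := (Matrix.isUnit_iff_isUnit_det _).1 hX.isUnit
  have hb : IsUnit B.det := (Matrix.isUnit_iff_isUnit_det _).1 hB.isUnit
  have h1 := Matrix.mul_nonsing_inv _ hu
  have h2 := Matrix.nonsing_inv_mul _ hu
  rw [← h, Matrix.mul_inv_rev, Matrix.mul_inv_rev, Matrix.nonsing_inv_nonsing_inv _ hb]
  calc X * (X⁻¹ * (B * X⁻¹)) * X = (X * X⁻¹) * B * (X⁻¹ * X) := by simp only [mul_assoc]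
    _ = B := by rw [h1, h2, mul_one, one_mul]

section
open scoped Matrix.Norms.L2Operator

theorem matrix_sqrt_le_sqrt {n : ℕ} {A B : Matrix (Fin n) (Fin n) ℂ} (h : A ≤ B) :
    CFC.sqrt A ≤ CFC.sqrt B :=
  CFC.sqrt_le_sqrt A B h

theorem matrix_continuousOn_sqrt {n : ℕ} :
    ContinuousOn (CFC.sqrt : Matrix (Fin n) (Fin n) ℂ → Matrix (Fin n) (Fin n) ℂ) {A | 0 ≤ A} :=
  CFC.continuousOn_sqrt

/-- A decreasing family of positive semidefinite matrices converges. -/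
theorem exists_tendsto_of_decreasing {n : ℕ} (F : ℝ → Matrix (Fin n) (Fin n) ℂ)
    (h0 : ∀ ε, 0 < ε → 0 ≤ F ε) (hF : ∀ δ ε, 0 < δ → δ ≤ ε → F δ ≤ F ε) :
    ∃ G, Filter.Tendsto F (nhdsWithin (0 : ℝ) (Set.Ioi 0)) (nhds G) := by
  have hK : IsCompact (Metric.closedBall (0 : Matrix (Fin n) (Fin n) ℂ) ‖F 1‖) :=
    isCompact_closedBall _ _
  have hmem : ∀ᶠ ε in nhdsWithin (0 : ℝ) (Set.Ioi 0),
      F ε ∈ Metric.closedBall (0 : Matrix (Fin n) (Fin n) ℂ) ‖F 1‖ := by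
    filter_upwards [Ioo_mem_nhdsGT (zero_lt_one (α := ℝ))] with ε hε
    rw [mem_closedBall_zero_iff]
    exact CStarAlgebra.norm_le_norm_of_nonneg_of_le (h0 ε hε.1) (hF ε 1 hε.1 hε.2.le)
  have hle : ∀ x, MapClusterPt x (nhdsWithin (0 : ℝ) (Set.Ioi 0)) F → ∀ ε, 0 < ε → x ≤ F ε := by
    intro x hx ε hε
    refine isClosed_Iic.mem_of_mapClusterPt (s := Set.Iic (F ε)) hx ?_
    filter_upwards [Ioo_mem_nhdsGT hε] with δ hδ
    exact hF δ ε hδ.1 hδ.2.le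
  have hle2 : ∀ x y, MapClusterPt x (nhdsWithin (0 : ℝ) (Set.Ioi 0)) F →
      MapClusterPt y (nhdsWithin (0 : ℝ) (Set.Ioi 0)) F → x ≤ y := by
    intro x y hx hy
    refine isClosed_Ici.mem_of_mapClusterPt (s := Set.Ici x) hy ?_
    filter_upwards [self_mem_nhdsWithin] with δ hδ
    exact hle x hx δ hδ
  obtain ⟨G, -, hG⟩ := hK.exists_mapClusterPt_of_frequently hmem.frequently
  exact ⟨G, hK.tendsto_nhds_of_unique_mapClusterPt hmem fun x _ hx =>
    le_antisymm (hle2 x G hx hG) (hle2 G x hG hx)⟩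

theorem matrix_isClosed_nonneg {n : ℕ} : IsClosed {A : Matrix (Fin n) (Fin n) ℂ | 0 ≤ A} :=
  CStarAlgebra.isClosed_nonneg

end

theorem conj_mono {n : ℕ} {A A' S : Matrix (Fin n) (Fin n) ℂ} (h : A ≤ A') (hS : S.IsHermitian) :
    S * A * S ≤ S * A' * S := by
  have h1 := (Matrix.le_iff.1 h).conjTranspose_mul_mul_same S
  rw [hS.eq] at h1
  rw [Matrix.le_iff]
  convert h1 using 1
  rw [mul_sub, sub_mul]

theorem geomMeanPosDef_mono_left {n : ℕ} {A A' B : Matrix (Fin n) (Fin n) ℂ}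
    (h : A ≤ A') (hB : B.PosDef) : geomMeanPosDef A B ≤ geomMeanPosDef A' B :=
  conj_mono (matrix_sqrt_le_sqrt (conj_mono h (posDef_sqrt hB).inv.isHermitian))
    (posDef_sqrt hB).isHermitian

theorem geomMeanPosDef_mono {n : ℕ} {A A' B B' : Matrix (Fin n) (Fin n) ℂ}
    (hA' : A'.PosDef) (hB : B.PosDef) (hB' : B'.PosDef)
    (h : A ≤ A') (h' : B ≤ B') : geomMeanPosDef A B ≤ geomMeanPosDef A' B' := by
  refine (geomMeanPosDef_mono_left h hB).trans ?_
  rw [geomMeanPosDef_comm hA' hB, geomMeanPosDef_comm hA' hB']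
  exact geomMeanPosDef_mono_left h' hA'

theorem posDef_add_smul_one {n : ℕ} {A : Matrix (Fin n) (Fin n) ℂ} (hA : A.PosSemidef)
    {ε : ℝ} (hε : 0 < ε) : (A + (ε : ℂ) • (1 : Matrix (Fin n) (Fin n) ℂ)).PosDef := by
  have h : ((ε : ℂ) • (1 : Matrix (Fin n) (Fin n) ℂ)).PosDef :=
    Matrix.PosDef.smul Matrix.PosDef.one (by exact_mod_cast hε)
  exact Matrix.PosDef.posSemidef_add hA h

theorem add_smul_one_mono {n : ℕ} (A : Matrix (Fin n) (Fin n) ℂ) {δ ε : ℝ} (h : δ ≤ ε) :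
    A + (δ : ℂ) • (1 : Matrix (Fin n) (Fin n) ℂ) ≤ A + (ε : ℂ) • (1 : Matrix (Fin n) (Fin n) ℂ) := by
  rw [Matrix.le_iff]
  have h1 : (((ε - δ : ℝ) : ℂ) • (1 : Matrix (Fin n) (Fin n) ℂ)).PosSemidef :=
    Matrix.PosSemidef.smul Matrix.PosSemidef.one (by exact_mod_cast sub_nonneg.2 h)
  have h2 : A + (ε : ℂ) • (1 : Matrix (Fin n) (Fin n) ℂ) - (A + (δ : ℂ) • 1) =
      ((ε - δ : ℝ) : ℂ) • (1 : Matrix (Fin n) (Fin n) ℂ) := by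
    rw [Complex.ofReal_sub, sub_smul, add_sub_add_left_eq_sub]
  rw [h2]
  exact h1

/-- The limit defining the geometric mean of positive semidefinite matrices exists. -/
theorem tendsto_geomMean {n : ℕ} {A B : Matrix (Fin n) (Fin n) ℂ}
    (hA : A.PosSemidef) (hB : B.PosSemidef) :
    Filter.Tendsto (fun ε : ℝ =>
      geomMeanPosDef (A + (ε : ℂ) • (1 : Matrix (Fin n) (Fin n) ℂ))
        (B + (ε : ℂ) • (1 : Matrix (Fin n) (Fin n) ℂ)))
      (nhdsWithin (0 : ℝ) (Set.Ioi 0)) (nhds (geomMean A B)) := by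
  refine tendsto_nhds_limUnder (exists_tendsto_of_decreasing _ ?_ ?_)
  · intro ε hε
    exact (geomMeanPosDef_posDef (posDef_add_smul_one hA hε)
      (posDef_add_smul_one hB hε)).posSemidef.nonneg
  · intro δ ε hδ h
    have hε := hδ.trans_le h
    exact geomMeanPosDef_mono (posDef_add_smul_one hA hε)
      (posDef_add_smul_one hB hδ) (posDef_add_smul_one hB hε)
      (add_smul_one_mono A h) (add_smul_one_mono B h)

theorem geomMean_posSemidef {n : ℕ} {A B : Matrix (Fin n) (Fin n) ℂ}
    (hA : A.PosSemidef) (hB : B.PosSemidef) : (geomMean A B).PosSemidef := by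
  refine Matrix.nonneg_iff_posSemidef.1
    (matrix_isClosed_nonneg.mem_of_tendsto (tendsto_geomMean hA hB) ?_)
  filter_upwards [self_mem_nhdsWithin] with ε hε
  exact (geomMeanPosDef_posDef (posDef_add_smul_one hA hε)
    (posDef_add_smul_one hB hε)).posSemidef.nonneg

/-- On positive definite matrices the limit agrees with the explicit formula. -/
theorem geomMean_eq_of_posDef {n : ℕ} {A B : Matrix (Fin n) (Fin n) ℂ}
    (hA : A.PosDef) (hB : B.PosDef) : geomMean A B = geomMeanPosDef A B := by
  have hp : ∀ {C : Matrix (Fin n) (Fin n) ℂ}, Filter.Tendsto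
      (fun ε : ℝ => C + (ε : ℂ) • (1 : Matrix (Fin n) (Fin n) ℂ))
      (nhdsWithin (0 : ℝ) (Set.Ioi 0)) (nhds C) := by
    intro C
    have hc : Continuous fun ε : ℝ => C + (ε : ℂ) • (1 : Matrix (Fin n) (Fin n) ℂ) := by fun_prop
    have := hc.tendsto 0
    simp only [Complex.ofReal_zero, zero_smul, add_zero] at this
    exact this.mono_left nhdsWithin_le_nhds
  have hq : ∀ {f : ℝ → Matrix (Fin n) (Fin n) ℂ} {C : Matrix (Fin n) (Fin n) ℂ}, C.PosSemidef →
      (∀ ε, 0 < ε → (f ε).PosSemidef) →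
      Filter.Tendsto f (nhdsWithin (0 : ℝ) (Set.Ioi 0)) (nhds C) →
      Filter.Tendsto (fun ε => CFC.sqrt (f ε)) (nhdsWithin (0 : ℝ) (Set.Ioi 0))
        (nhds (CFC.sqrt C)) := by
    intro f C hC hf h
    refine (matrix_continuousOn_sqrt C hC.nonneg).tendsto.comp
      (tendsto_nhdsWithin_iff.2 ⟨h, ?_⟩)
    filter_upwards [self_mem_nhdsWithin] with ε hε
    exact (hf ε hε).nonneg
  have hS := hq hB.posSemidef (fun ε hε => (posDef_add_smul_one hB.posSemidef hε).posSemidef)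
    (hp (C := B))
  have hdet : (CFC.sqrt B).det ≠ 0 :=
    ((Matrix.isUnit_iff_isUnit_det _).1 (posDef_sqrt hB).isUnit).ne_zero
  have hSi := (continuousAt_matrix_inv (CFC.sqrt B) (by
    simp only [Ring.inverse_eq_inv']
    exact continuousAt_inv₀ hdet)).tendsto.comp hS
  refine tendsto_nhds_unique (tendsto_geomMean hA.posSemidef hB.posSemidef) ?_
  refine (hS.mul (hq (posDef_conj hA (posDef_sqrt hB).inv).posSemidef ?_
    ((hSi.mul (hp (C := A))).mul hSi))).mul hS
  intro ε hε
  exact (posDef_conj (posDef_add_smul_one hA.posSemidef hε)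
    (posDef_sqrt (posDef_add_smul_one hB.posSemidef hε)).inv).posSemidef

/-- The eigenvalues of a Hermitian matrix, in nonincreasing order, with multiplicity; the index `j`
starts at `0`. -/
noncomputable def sortedEigenvalue {n : ℕ} {A : Matrix (Fin n) (Fin n) ℂ} (hA : A.IsHermitian)
    (j : Fin n) : ℝ :=
  hA.eigenvalues₀ (Fin.cast (Fintype.card_fin n).symm j)

/-- The singular values of a matrix, in nonincreasing order; the index `j` starts at `0`. -/
noncomputable def singularValue {n : ℕ} (A : Matrix (Fin n) (Fin n) ℂ) (j : Fin n) : ℝ :=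
  (Matrix.toEuclideanLin A).singularValues j

theorem posSemidef_toBlocks₁₁ {n : ℕ} {M : Matrix (Fin n ⊕ Fin n) (Fin n ⊕ Fin n) ℂ}
    (hM : M.PosSemidef) : M.toBlocks₁₁.PosSemidef :=
  hM.submatrix Sum.inl

theorem posSemidef_toBlocks₂₂ {n : ℕ} {M : Matrix (Fin n ⊕ Fin n) (Fin n ⊕ Fin n) ℂ}
    (hM : M.PosSemidef) : M.toBlocks₂₂.PosSemidef :=
  hM.submatrix Sum.inr

/-- For a positive semidefinite block matrix `M`, the Hermitian matrix `M₁₁ ♯ M₂₂`. -/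
theorem isHermitian_geomMean_blocks {n : ℕ} {M : Matrix (Fin n ⊕ Fin n) (Fin n ⊕ Fin n) ℂ}
    (hM : M.PosSemidef) : (geomMean M.toBlocks₁₁ M.toBlocks₂₂).IsHermitian :=
  (geomMean_posSemidef (posSemidef_toBlocks₁₁ hM) (posSemidef_toBlocks₂₂ hM)).isHermitian

/-- The lg-property: `∏_{j ≤ k} s_j(M₁₂) ≤ ∏_{j ≤ k} λ_j(M₁₁ ♯ M₂₂)` for all `k`. -/
def HasLgProperty {n : ℕ} {M : Matrix (Fin n ⊕ Fin n) (Fin n ⊕ Fin n) ℂ}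
    (hM : M.PosSemidef) : Prop :=
  ∀ k : Fin n, ∏ j ∈ Finset.Iic k, singularValue M.toBlocks₁₂ j ≤
    ∏ j ∈ Finset.Iic k, sortedEigenvalue (isHermitian_geomMean_blocks hM) j

/-! Everything reduces to one determinant estimate. Write `A`, `B` for the diagonal blocks and `C`
for the off-diagonal one. If `A` is positive definite, positivity of the block matrix means `C* A⁻¹
C ≤ B` (Schur complement), and monotonicity of the determinant gives `|det C|² ≤ det A · det B`. For
unitary `C` the left side is `1`, and a perturbation of `A` covers singular `A`.

The Riccati equation `X B⁻¹ X = A` for `X = A ♯ B` yields `det (A ♯ B)² = det A · det B`, which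
survives the limit `ε → 0⁺`. Hence the product of all eigenvalues of `A ♯ B` is at least `1`. These
are nonnegative and nonincreasing, so every initial product is at least `1`, while all singular
values of `C` equal `1`. -/

/-! ### Determinant inequalities in the Loewner order -/

/-- A Hermitian matrix above the identity in the Loewner order has determinant at least one. -/
theorem one_le_det_of_one_le {n : ℕ} {A : Matrix (Fin n) (Fin n) ℂ} (hA : A.IsHermitian)
    (h : 1 ≤ A) : 1 ≤ A.det := by
  rw [hA.det_eq_prod_eigenvalues]
  have h1 : ∀ i, 1 ≤ hA.eigenvalues i := fun i =>
    (CFC.one_le_iff A hA.isSelfAdjoint).1 h _ (hA.eigenvalues_mem_spectrum_real i)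
  have h2 : 1 ≤ ∏ i, hA.eigenvalues i := Finset.one_le_prod fun i _ => h1 i
  rw [← RCLike.ofReal_prod]
  exact Complex.real_le_real.2 h2

/-- The determinant is monotone on positive definite matrices. -/
theorem det_le_det_of_le {n : ℕ} {A B : Matrix (Fin n) (Fin n) ℂ} (hA : A.PosDef)
    (hB : B.IsHermitian) (h : A ≤ B) : A.det ≤ B.det := by
  have hS := posDef_sqrt hA
  have hSS : CFC.sqrt A * CFC.sqrt A = A := CFC.sqrt_mul_sqrt_self A hA.posSemidef.nonneg
  have hu : IsUnit (CFC.sqrt A).det := (Matrix.isUnit_iff_isUnit_det _).1 hS.isUnit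
  -- Conjugation by `A^{-1/2}` turns `A ≤ B` into `1 ≤ A^{-1/2} B A^{-1/2}`, a matrix of determinant
  -- `det B / det A`.
  have hc := conj_mono h hS.inv.isHermitian
  have hBh : ((CFC.sqrt A)⁻¹ * B * (CFC.sqrt A)⁻¹).IsHermitian := by
    have := Matrix.isHermitian_conjTranspose_mul_mul (CFC.sqrt A)⁻¹ hB
    rwa [hS.inv.isHermitian.eq] at this
  generalize CFC.sqrt A = S at hSS hu hc hBh
  subst hSS
  rw [← mul_assoc, Matrix.nonsing_inv_mul S hu, one_mul, Matrix.mul_nonsing_inv S hu] at hc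
  have h1 := mul_le_mul_of_nonneg_left (one_le_det_of_one_le hBh hc) hA.posSemidef.det_nonneg
  rw [mul_one] at h1
  refine h1.trans_eq ?_
  simp only [Matrix.det_mul, Matrix.det_nonsing_inv, Ring.inverse_eq_inv']
  field_simp [hu.ne_zero]

/-- The determinant of the off-diagonal block of a positive semidefinite block matrix is controlled
by those of the diagonal blocks. -/
theorem det_mul_det_conjTranspose_le {n : ℕ} {A B C : Matrix (Fin n) (Fin n) ℂ} (hA : A.PosDef)
    (hC : IsUnit C) (h : (Matrix.fromBlocks A C C.conjTranspose B).PosSemidef) :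
    C.conjTranspose.det * C.det ≤ A.det * B.det := by
  let := hA.isUnit.invertible
  have hB : B.IsHermitian := (posSemidef_toBlocks₂₂ h).isHermitian
  have hK : (C.conjTranspose * A⁻¹ * C).PosDef :=
    (Matrix.IsUnit.posDef_star_left_conjugate_iff hC).2 hA.inv
  -- The Schur complement `B - C* A⁻¹ C` is positive semidefinite; invertibility of `C` makes `C*
  -- A⁻¹ C` definite, as determinant monotonicity requires here.
  have hle := det_le_det_of_le hK hB
    (Matrix.le_iff.2 ((Matrix.PosDef.fromBlocks₁₁ C B hA).1 h))
  have h1 := mul_le_mul_of_nonneg_left hle hA.posSemidef.det_nonneg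
  refine le_trans (le_of_eq ?_) h1
  have hu : A.det ≠ 0 := hA.det_pos.ne'
  simp only [Matrix.det_mul, Matrix.det_nonsing_inv, Ring.inverse_eq_inv']
  field_simp

/-! ### Determinant of the geometric mean -/

/-- Determinants of both sides of the Riccati equation. -/
theorem geomMeanPosDef_det_sq {n : ℕ} {A B : Matrix (Fin n) (Fin n) ℂ}
    (hA : A.PosDef) (hB : B.PosDef) : (geomMeanPosDef A B).det ^ 2 = A.det * B.det := by
  have h := congrArg Matrix.det (geomMeanPosDef_riccati hA hB)
  simp only [Matrix.det_mul, Matrix.det_nonsing_inv, Ring.inverse_eq_inv'] at h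
  have hu : B.det ≠ 0 := hB.det_pos.ne'
  rw [← h]
  field_simp

/-- Both sides are limits of the positive definite case, by continuity of the determinant. -/
theorem geomMean_det_sq {n : ℕ} {A B : Matrix (Fin n) (Fin n) ℂ}
    (hA : A.PosSemidef) (hB : B.PosSemidef) : (geomMean A B).det ^ 2 = A.det * B.det := by
  have hdet : Continuous fun X : Matrix (Fin n) (Fin n) ℂ => X.det := continuous_id.matrix_det
  have hp : Continuous fun ε : ℝ => (A + (ε : ℂ) • (1 : Matrix (Fin n) (Fin n) ℂ)).det *
      (B + (ε : ℂ) • (1 : Matrix (Fin n) (Fin n) ℂ)).det :=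
    (hdet.comp (by fun_prop)).mul (hdet.comp (by fun_prop))
  have h0 := (hp.tendsto 0).mono_left (nhdsWithin_le_nhds (s := Set.Ioi 0))
  simp only [Complex.ofReal_zero, zero_smul, add_zero] at h0
  refine tendsto_nhds_unique (((hdet.tendsto _).comp (tendsto_geomMean hA hB)).pow 2)
    (h0.congr' ?_)
  filter_upwards [self_mem_nhdsWithin] with ε hε
  exact (geomMeanPosDef_det_sq (posDef_add_smul_one hA hε) (posDef_add_smul_one hB hε)).symm

/-! ### Ordered eigenvalues and singular values -/

theorem antitone_sortedEigenvalue {n : ℕ} {A : Matrix (Fin n) (Fin n) ℂ} (hA : A.IsHermitian) :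
    Antitone (sortedEigenvalue hA) := fun _ _ h =>
  hA.eigenvalues₀_antitone h

theorem sortedEigenvalue_nonneg {n : ℕ} {A : Matrix (Fin n) (Fin n) ℂ} (hA : A.PosSemidef)
    (j : Fin n) : 0 ≤ sortedEigenvalue hA.isHermitian j := by
  have h := hA.eigenvalues_nonneg
    -- `eigenvalues` is `eigenvalues₀` reindexed by this equivalence, so this index recovers the
    -- `j`-th sorted eigenvalue.
    ((Fintype.equivOfCardEq (Fintype.card_fin _)) (Fin.cast (Fintype.card_fin n).symm j))
  rwa [Matrix.IsHermitian.eigenvalues, Equiv.symm_apply_apply] at h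

theorem det_eq_prod_sortedEigenvalue {n : ℕ} {A : Matrix (Fin n) (Fin n) ℂ} (hA : A.IsHermitian) :
    A.det = ((∏ j, sortedEigenvalue hA j : ℝ) : ℂ) := by
  have h : ∏ j, sortedEigenvalue hA j = ∏ i, hA.eigenvalues i := by
    refine Fintype.prod_equiv ((finCongr (Fintype.card_fin n).symm).trans
      (Fintype.equivOfCardEq (Fintype.card_fin _))) _ _ fun j => ?_
    simp [sortedEigenvalue, Matrix.IsHermitian.eigenvalues]
  rw [hA.det_eq_prod_eigenvalues, h]
  push_cast
  rfl

/-- If the product of a nonincreasing sequence of nonnegative reals is at least one, then so are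
the products over its initial segments. -/
theorem one_le_prod_Iic_of_antitone {n : ℕ} {f : Fin n → ℝ} (hf : Antitone f)
    (h0 : ∀ j, 0 ≤ f j) (h : 1 ≤ ∏ j, f j) (k : Fin n) : 1 ≤ ∏ j ∈ Finset.Iic k, f j := by
  -- If `f k ≥ 1`, every factor up to `k` is at least `1`. Otherwise the omitted factors lie in `[0,
  -- 1]`, so the initial product dominates the full one.
  rcases le_total 1 (f k) with hk | hk
  · exact Finset.one_le_prod fun j hj => hk.trans (hf (Finset.mem_Iic.1 hj))
  · refine h.trans ?_
    rw [← Finset.prod_mul_prod_compl (Finset.Iic k) f]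
    refine mul_le_of_le_one_right (Finset.prod_nonneg fun j _ => h0 j)
      (Finset.prod_le_one (fun j _ => h0 j) fun j hj => (hf ?_).trans hk)
    rw [Finset.mem_compl, Finset.mem_Iic, not_le] at hj
    exact hj.le

/-- The squared singular values are eigenvalues of `U* U = 1`. -/
theorem singularValue_eq_one {n : ℕ} {U : Matrix (Fin n) (Fin n) ℂ}
    (hU : U ∈ Matrix.unitaryGroup (Fin n) ℂ) (j : Fin n) : singularValue U j = 1 := by
  have hid : (Matrix.toEuclideanLin U).adjoint ∘ₗ Matrix.toEuclideanLin U = LinearMap.id := by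
    have h := Matrix.mem_unitaryGroup_iff'.1 hU
    rw [← Matrix.toEuclideanLin_conjTranspose_eq_adjoint]
    rw [Matrix.star_eq_conjTranspose] at h
    ext x i
    simp [Matrix.toLpLin_apply, Matrix.mulVec_mulVec, h]
  have he := (Matrix.toEuclideanLin U).hasEigenvalue_adjoint_comp_self_sq_singularValues
    (n := j) (by simp)
  rw [hid] at he
  obtain ⟨v, hv⟩ := he.exists_hasEigenvector
  have h1 := hv.apply_eq_smul
  have hs : (((Matrix.toEuclideanLin U).singularValues j : ℂ) ^ 2 - 1) • v = 0 := by
    rw [sub_smul, one_smul, sub_eq_zero]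
    exact h1.symm
  have h2 := sub_eq_zero.1 ((smul_eq_zero.1 hs).resolve_right hv.2)
  have h3 : (Matrix.toEuclideanLin U).singularValues j ^ 2 = 1 := by exact_mod_cast h2
  exact (pow_eq_one_iff_of_nonneg ((Matrix.toEuclideanLin U).singularValues_nonneg j) two_ne_zero).1 h3

theorem prod_singularValue_eq_one {n : ℕ} {U : Matrix (Fin n) (Fin n) ℂ}
    (hU : U ∈ Matrix.unitaryGroup (Fin n) ℂ) (s : Finset (Fin n)) :
    ∏ j ∈ s, singularValue U j = 1 :=
  Finset.prod_eq_one fun j _ => singularValue_eq_one hU j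

/-! ### Unitary off-diagonal block -/

/-- If the off-diagonal block is unitary, the diagonal blocks have determinant product at least
one. -/
theorem one_le_det_mul_det {n : ℕ} {M : Matrix (Fin n ⊕ Fin n) (Fin n ⊕ Fin n) ℂ}
    (hM : M.PosSemidef) (hU : M.toBlocks₁₂ ∈ Matrix.unitaryGroup (Fin n) ℂ) :
    1 ≤ M.toBlocks₁₁.det * M.toBlocks₂₂.det := by
  have hdet : Continuous fun X : Matrix (Fin n) (Fin n) ℂ => X.det := continuous_id.matrix_det
  have hp : Continuous fun ε : ℝ =>
      (M.toBlocks₁₁ + (ε : ℂ) • (1 : Matrix (Fin n) (Fin n) ℂ)).det * M.toBlocks₂₂.det :=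
    (hdet.comp (by fun_prop)).mul continuous_const
  have h0 := (hp.tendsto 0).mono_left (nhdsWithin_le_nhds (s := Set.Ioi 0))
  simp only [Complex.ofReal_zero, zero_smul, add_zero] at h0
  -- Only the upper left block is perturbed: the Schur complement inverts no other block, and the
  -- bound `1` does not depend on `ε`.
  refine ge_of_tendsto h0 ?_
  filter_upwards [self_mem_nhdsWithin] with ε hε
  have h21 : M.toBlocks₂₁ = M.toBlocks₁₂.conjTranspose := by
    ext i j
    exact (hM.isHermitian.apply (Sum.inr i) (Sum.inl j)).symm
  have hE : (Matrix.fromBlocks ((ε : ℂ) • (1 : Matrix (Fin n) (Fin n) ℂ)) 0 0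
      (0 : Matrix (Fin n) (Fin n) ℂ)).PosSemidef := by
    have hd : Matrix.fromBlocks ((ε : ℂ) • (1 : Matrix (Fin n) (Fin n) ℂ)) 0 0 0 =
        Matrix.diagonal (Sum.elim (fun _ : Fin n => (ε : ℂ)) (fun _ : Fin n => 0)) := by
      rw [← Matrix.fromBlocks_diagonal, Matrix.smul_one_eq_diagonal, Matrix.diagonal_zero]
    rw [hd, Matrix.posSemidef_diagonal_iff]
    have hε' : (0 : ℂ) ≤ ε := by exact_mod_cast (Set.mem_Ioi.1 hε).le
    rintro (i | i) <;> simp [hε']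
  have hB := hM.add hE
  rw [← M.fromBlocks_toBlocks, Matrix.fromBlocks_add, h21, add_zero, add_zero, add_zero] at hB
  have h := det_mul_det_conjTranspose_le (posDef_add_smul_one (posSemidef_toBlocks₁₁ hM) hε)
    (IsUnit.of_mul_eq_one _ (Matrix.mem_unitaryGroup_iff.1 hU)) hB
  rwa [← Matrix.det_mul, ← Matrix.star_eq_conjTranspose, Matrix.mem_unitaryGroup_iff'.1 hU,
    Matrix.det_one] at h

theorem one_le_prod_sortedEigenvalue_geomMean {n : ℕ}
    {M : Matrix (Fin n ⊕ Fin n) (Fin n ⊕ Fin n) ℂ} (hM : M.PosSemidef)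
    (hU : M.toBlocks₁₂ ∈ Matrix.unitaryGroup (Fin n) ℂ) (k : Fin n) :
    1 ≤ ∏ j ∈ Finset.Iic k, sortedEigenvalue (isHermitian_geomMean_blocks hM) j := by
  have hA := posSemidef_toBlocks₁₁ hM
  have hB := posSemidef_toBlocks₂₂ hM
  have h0 := sortedEigenvalue_nonneg (geomMean_posSemidef hA hB)
  refine one_le_prod_Iic_of_antitone (antitone_sortedEigenvalue _) h0 ?_ k
  have h := one_le_det_mul_det hM hU
  rw [← geomMean_det_sq hA hB, det_eq_prod_sortedEigenvalue (isHermitian_geomMean_blocks hM)] at h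
  -- The inequality in the order of `ℂ` is between real numbers, so it descends to `ℝ`, where the
  -- square can be removed by nonnegativity.
  have h1 : 1 ≤ (∏ j, sortedEigenvalue (isHermitian_geomMean_blocks hM) j) ^ 2 := by
    exact_mod_cast h
  exact (one_le_sq_iff₀ (Finset.prod_nonneg fun j _ => h0 j)).1 h1

theorem mainTheorem2 {n : ℕ} (M : Matrix (Fin n ⊕ Fin n) (Fin n ⊕ Fin n) ℂ)
    (hM : M.PosSemidef) (hU : M.toBlocks₁₂ ∈ Matrix.unitaryGroup (Fin n) ℂ) :
    (∀ k : Fin n,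
      (1 = ∏ j ∈ Finset.Iic k, singularValue M.toBlocks₁₂ j) ∧
      (1 ≤ ∏ j ∈ Finset.Iic k, sortedEigenvalue (isHermitian_geomMean_blocks hM) j)) ∧
    HasLgProperty hM :=
  ⟨fun k => ⟨(prod_singularValue_eq_one hU _).symm, one_le_prod_sortedEigenvalue_geomMean hM hU k⟩,
    fun k => (prod_singularValue_eq_one hU _).trans_le
      (one_le_prod_sortedEigenvalue_geomMean hM hU k)⟩
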